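/- Let $p\in[1,\infty)$ and, for each $i\in\mathbb N$, let $\mathbb R^{n_i}$ carry a fixed norm $|\cdot|$; let $X=\ell^p(\mathbb N,(n_i))=\{x=(x_i)_{i\in\mathbb N}: x_i\in\mathbb R^{n_i},\ |x|_p:=(\sum_i|x_i|^p)^{1/p}<\infty\}$, and let $X\times X$ carry the norm $\|(x,\hat x)\|=\sqrt{|x|_p^2+|\hat x|_p^2}$. For each $i$ let $I_i\subset\mathbb N\setminus\{i\}$ be finite, and for a family $(z_j)_{j\in\mathbb N}$ write $\bar z_i=(z_j)_{j\in I_i}$. Consider the infinite network of plants with local observers (the composite system) $$\dot x_i=f_i(x_i,\bar x_i),\qquad y_i=h_i(x_i,\bar x_i)\in\mathbb R^{p_i},\qquad \dot{\hat x}_i=\hat f_i(\hat x_i,y_i,\bar y_i,\bar{\hat x}_i),\qquad i\in\mathbb N,\qquad(*)$$ with continuous $f_i,h_i,\hat f_i$. A solution of $(*)$ on $[0,T)$, $0<T\le\infty$, is a continuous curve in $X\times X$ along which the right-hand side of $(*)$ lies in $X\times X$ and which satisfies the integrated equation with a Bochner integral. Assume the following. (i) $(*)$ is well-posed on $X\times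 X$: for every initial value $(x,\hat x)\in X\times X$ there is a unique local solution, denoted by $(\phi(t,x),\hat\phi(t,\hat x))$ with components $\phi_i,\hat\phi_i$. (ii) There are continuous functions $V_i:\mathbb R^{n_i}\times\mathbb R^{n_i}\to[0,\infty)$ and constants $\underline\alpha_i,\overline\alpha_i,\lambda_i>0$ and $\gamma_{ij}>0$ ($j\in I_i$), with $\gamma_{ij}:=0$ for $j\notin I_i$, such that $\underline\alpha_i|x_i-\hat x_i|^p\le V_i(x_i,\hat x_i)\le\overline\alpha_i|x_i-\hat x_i|^p$ for all $x_i,\hat x_i\in\mathbb R^{n_i}$, and such that along every solution of $(*)$ and for every $i$ the right upper Dini derivative satisfies $$D^+(V_i\circ(\phi_i,\hat\phi_i))(t)\le-\lambda_iV_i(\phi_i(t),\hat\phi_i(t))+\sum_{j\in I_i}\gamma_{ij}V_j(\phi_j(t),\hat\phi_j(t))$$ for almost all $t$ in the interval of existence, while the right lower Dini derivative satisfies $D_+(V_i\circ(\phi_i,\hat\phi_i))(t)<\infty$ for all such $t$. Moreover there are constants $\underline\alpha,\overline\alpha,\underline\lambda>0$ with $\underline\alpha\le\underline\alpha_i\le\overline\alpha_i\le\overline\alpha$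 and $\underline\lambda\le\lambda_i$ for all $i$. (iii) $\sup_j\sum_i\gamma_{ij}<\infty$, i.e. $\Gamma=(\gamma_{ij})$ is a bounded operator on $\ell^1$. (iv) The bounded operator $\Psi=(\gamma_{ij}/\lambda_i)_{i,j}$ on $\ell^1$ has spectral radius $r(\Psi)<1$. Let $\mathcal A=\{(x,\hat x)\in X\times X: x=\hat x\}$ and denote by $|\cdot|_{\mathcal A}$ the distance to $\mathcal A$ in $X\times X$. Then there are constants $\underline\mu,\overline\mu>0$ and numbers $\mu_i\in[\underline\mu,\overline\mu]$ such that $$V(x,\hat x)=\sum_{i=1}^\infty\mu_iV_i(x_i,\hat x_i)$$ converges on $X\times X$ and is an exponential Lyapunov function of $(*)$ with respect to $\mathcal A$, with the following properties. (a) $V$ is continuous on $(X\times X)\setminus\mathcal A$. (b) There is $\lambda_\infty>0$ such that for every initial value $z^0\in(X\times X)\setminus\mathcal A$ the right upper Dini derivative at $t=0$ of $V$ along the solution starting at $z^0$ is at most $-\lambda_\infty V(z^0)$. (c) $\underline\mu\,\underline\alpha\,|(x,\hat x)|_{\mathcal A}^p\le V(x,\hat x)\le\overline\mu\,\overline\alpha\,|(x,\hat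 x)|_{\mathcal A}^p$ for all $x,\hat x\in X$. Consequently the error dynamics of $(*)$ is globally exponentially stable (the local observers form a robust distributed observer): there are $M,a>0$ such that for all $x,\hat x\in X$ and all $t\ge0$ in the interval of existence of the solution (that is, for all $t\ge0$ whenever the solution is global) $$|\phi(t,x)-\hat\phi(t,\hat x)|_p\le M\mathrm e^{-at}|x-\hat x|_p .$$ -/

import Mathlib

open MeasureTheory Filter Topology
open scoped ENNReal NNReal

/-- The right upper Dini derivative of `g` at `t`, as an extended real number. -/
noncomputable def upperDini (g : ℝ → ℝ) (t : ℝ) : EReal :=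
  limsup (fun h : ℝ => (((g (t + h) - g t) / h : ℝ) : EReal)) (𝓝[>] (0 : ℝ))

/-- The right lower Dini derivative of `g` at `t`, as an extended real number. -/
noncomputable def lowerDini (g : ℝ → ℝ) (t : ℝ) : EReal :=
  liminf (fun h : ℝ => (((g (t + h) - g t) / h : ℝ) : EReal)) (𝓝[>] (0 : ℝ))

/-- The interval `[0, T)` for `T ∈ [-∞, ∞]`. -/
def timeInterval (T : EReal) : Set ℝ := {t | 0 ≤ t ∧ (t : EReal) < T}

/-- An infinite network of plants `ẋ_i = f_i (x_i, (x_j)_{j ∈ I_i})`, `y_i = h_i (x_i, (x_j)_{j ∈ I_i})`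
with local observers `d/dt x̂_i = f̂_i (x̂_i, y_i, (y_j)_{j ∈ I_i}, (x̂_j)_{j ∈ I_i})`.
The space `E i` is the state space of the `i`-th plant with its chosen norm, `ℝ^(q i)` is the space
of values of the `i`-th output, and `nbr i` is the finite set `I_i` of neighbours. -/
structure ObservedNetwork (E : ℕ → Type*) [∀ i, NormedAddCommGroup (E i)] (q : ℕ → ℕ) where
  nbr : ℕ → Finset ℕ
  not_mem_nbr : ∀ i, i ∉ nbr i
  /-- right-hand sides of the plants -/
  f : ∀ i, E i × (∀ j : nbr i, E j) → E i
  /-- output maps -/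
  h : ∀ i, E i × (∀ j : nbr i, E j) → (Fin (q i) → ℝ)
  /-- right-hand sides of the local observers -/
  fhat : ∀ i, E i × (Fin (q i) → ℝ) × (∀ j : nbr i, Fin (q j) → ℝ) × (∀ j : nbr i, E j) → E i
  continuous_f : ∀ i, Continuous (f i)
  continuous_h : ∀ i, Continuous (h i)
  continuous_fhat : ∀ i, Continuous (fhat i)

/-- The state space `X × X` of the composite system, where `X` is the `ℓ^p`-sum of the spaces `E i`,
with the norm `‖(x, x̂)‖ = √(‖x‖² + ‖x̂‖²)`. -/
abbrev CompositeState (E : ℕ → Type*) [∀ i, NormedAddCommGroup (E i)] (p : ℝ≥0∞) : Type _ :=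
  WithLp 2 (lp E p × lp E p)

/-- The diagonal `{(x, x̂) : x = x̂}` of `X × X`. -/
def diagonalSet (E : ℕ → Type*) [∀ i, NormedAddCommGroup (E i)] (p : ℝ≥0∞) :
    Set (CompositeState E p) :=
  {z | z.fst = z.snd}

namespace ObservedNetwork

variable {E : ℕ → Type*} [∀ i, NormedAddCommGroup (E i)] {q : ℕ → ℕ}

/-- The output `y_i` of the `i`-th plant when the network is in the state `x`. -/
def output (N : ObservedNetwork E q) (x : ∀ i, E i) (i : ℕ) : Fin (q i) → ℝ :=
  N.h i (x i, fun j => x j)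

/-- The plant part of the right-hand side of the composite system. -/
def plantRhs (N : ObservedNetwork E q) (x : ∀ i, E i) (i : ℕ) : E i :=
  N.f i (x i, fun j => x j)

/-- The observer part of the right-hand side of the composite system. -/
def observerRhs (N : ObservedNetwork E q) (x xhat : ∀ i, E i) (i : ℕ) : E i :=
  N.fhat i (xhat i, N.output x i, fun j => N.output x j, fun j => xhat j)

variable [∀ i, NormedSpace ℝ (E i)] {p : ℝ≥0∞} [Fact (1 ≤ p)]

/-- `ξ` is a solution on `[0, T)`, `0 < T ≤ ∞`, of the composite system with initial value `z0`:
it is continuous with values in `X × X`, the right-hand side along `ξ` (the curve `v`) lies in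
`X × X` and is Bochner integrable, and the integrated equation holds. -/
def IsSolution (N : ObservedNetwork E q) (z0 : CompositeState E p) (T : EReal)
    (ξ : ℝ → CompositeState E p) : Prop :=
  0 < T ∧ ContinuousOn ξ (timeInterval T) ∧
    ∃ v : ℝ → CompositeState E p,
      (∀ t ∈ timeInterval T, ∀ i,
        (v t).fst i = N.plantRhs (ξ t).fst i ∧
        (v t).snd i = N.observerRhs (ξ t).fst (ξ t).snd i) ∧
      ∀ t ∈ timeInterval T, IntervalIntegrable v volume 0 t ∧ ξ t = z0 + ∫ s in (0 : ℝ)..t, v s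

/-- The composite system is well-posed on `X × X`: for every initial value a local solution exists,
and two solutions with the same initial value coincide as long as both are defined. -/
def WellPosed (N : ObservedNetwork E q) (p : ℝ≥0∞) [Fact (1 ≤ p)] : Prop :=
  (∀ z0 : CompositeState E p, ∃ T ξ, N.IsSolution z0 T ξ) ∧
  ∀ (z0 : CompositeState E p) (T₁ T₂ : EReal) (ξ₁ ξ₂ : ℝ → CompositeState E p),
    N.IsSolution z0 T₁ ξ₁ → N.IsSolution z0 T₂ ξ₂ →
      ∀ t ∈ timeInterval T₁ ∩ timeInterval T₂, ξ₁ t = ξ₂ t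

/-- The dissipative estimates for the error Lyapunov functions `V i` with decay rates `lam i` and
gains `γ i j`: along every solution of the composite system, the estimate holds at almost every time
of existence, and the right lower Dini derivative is not `+∞` at any time of existence. -/
def Dissipative (N : ObservedNetwork E q) (p : ℝ≥0∞) [Fact (1 ≤ p)]
    (V : ∀ i, E i × E i → ℝ) (lam : ℕ → ℝ) (γ : ℕ → ℕ → ℝ) : Prop :=
  ∀ (z0 : CompositeState E p) (T : EReal) (ξ : ℝ → CompositeState E p), N.IsSolution z0 T ξ →
    ∀ i,
      (∀ᵐ t : ℝ, t ∈ timeInterval T →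
        upperDini (fun s => V i ((ξ s).fst i, (ξ s).snd i)) t ≤
          ((-lam i * V i ((ξ t).fst i, (ξ t).snd i) +
            ∑ j ∈ N.nbr i, γ i j * V j ((ξ t).fst j, (ξ t).snd j) : ℝ) : EReal)) ∧
      ∀ t ∈ timeInterval T, lowerDini (fun s => V i ((ξ s).fst i, (ξ s).snd i)) t < ⊤

/-- `V` is an exponential Lyapunov function of the composite system with respect to the set `A`. -/
def IsExpLyapunov (N : ObservedNetwork E q) (A : Set (CompositeState E p))
    (V : CompositeState E p → ℝ) : Prop :=
  (∀ z, 0 ≤ V z) ∧ ContinuousOn V Aᶜ ∧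
    ∃ ω₁ ω₂ b κ : ℝ, 0 < ω₁ ∧ 0 < ω₂ ∧ 0 < b ∧ 0 < κ ∧
      (∀ z, ω₁ * Metric.infDist z A ^ b ≤ V z ∧ V z ≤ ω₂ * Metric.infDist z A ^ b) ∧
      ∀ z0 ∉ A, ∀ T ξ, N.IsSolution z0 T ξ →
        upperDini (fun t => V (ξ t)) 0 ≤ ((-κ * V z0 : ℝ) : EReal)

end ObservedNetwork

/-- `S` is the bounded operator on (complex) `ℓ¹` given by the infinite real matrix `ψ`,
i.e. `(S x)_i = ∑_j ψ_ij x_j`. The complex space is used so that the spectral radius of `S`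
is the usual one. -/
def IsMatrixOperator (ψ : ℕ → ℕ → ℝ)
    (S : lp (fun _ : ℕ => ℂ) 1 →L[ℂ] lp (fun _ : ℕ => ℂ) 1) : Prop :=
  ∀ (x : lp (fun _ : ℕ => ℂ) 1) (i : ℕ), HasSum (fun j => (ψ i j : ℂ) * x j) (S x i)

/-!
Let `e = x - x̂` and `W = ∑ μ i * V i`, with weights `μ` still to be chosen.

*Weights.* The column sums `powColSum ψ k` of the powers of the nonnegative matrix `ψ = Λ⁻¹ Γ` are
bounded by `‖Ψᵏ‖` (`powColSum_le`). Since the spectral radius is less than one, `‖Ψⁿ‖ < 1` for some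
`n`, and the row vector `ν = ∑_{k < n} (1, 1, …) ψᵏ` satisfies `ν ψ ≤ ν - δ` with a uniform
`δ > 0` (`exists_subinvariant_row`). The weights are `μ i = ν i / lam i + ε`: the summand `ε` keeps
them away from zero when the rates `lam i` are unbounded, and as `Γ` is bounded on `ℓ¹` it costs at
most half of `δ`. The result is `μ Γ ≤ μ (Λ - κ)` with `κ > 0` (`exists_weights`).

*Dissipation in integrated form.* A continuous function whose upper Dini derivative is bounded
almost everywhere by a continuous `g`, and whose lower Dini derivative is nowhere `+∞`, grows at most
by `∫ g` (`sub_le_integral_of_upperDini_le`); the exceptional null set is absorbed by subtracting the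
primitive of a lower semicontinuous function that is infinite there and has small integral. Applied
to each `V i` along a solution and summed with the weights, this gives
`W (ξ b) - W (ξ a) ≤ -κ ∫ W (ξ t)` (`weighted_sum_sub_le_integral`). The sum is taken over `i < n`
first, because `∑ μ i * lam i * V i` need not converge; the error made by neighbours of index at
least `n` is a multiple of the tail of `W` and vanishes by dominated convergence.

*Conclusion.* `W` lies between multiples of `‖e‖ ^ p` and is a dominated series of continuous
functions, hence continuous. The integral inequality therefore yields the Dini estimate at time zero
and, by Grönwall's lemma, exponential decay of `W`, hence of `‖e‖`. The distance to the diagonal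
lies between `‖e‖ / √2` and `‖e‖`, so the upper bound for the weights is enlarged by `√2 ^ p`.
-/

/-! ### Comparison of a function with the integral of a bound on its Dini derivative -/

theorem tendsto_const_add_nhdsGT_zero (x : ℝ) :
    Tendsto (fun h : ℝ => x + h) (𝓝[>] 0) (𝓝[>] x) := by
  refine tendsto_nhdsWithin_iff.2 ⟨?_, ?_⟩
  · have : Tendsto (fun h : ℝ => x + h) (𝓝 0) (𝓝 (x + 0)) := (continuous_const_add x).tendsto 0
    rw [add_zero] at this
    exact this.mono_left nhdsWithin_le_nhds
  · filter_upwards [self_mem_nhdsWithin] with h hh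
    simpa using hh

theorem mul_le_integral_of_ae_le {G : ℝ → ℝ} {x y c : ℝ} (hxy : x ≤ y)
    (hG : IntervalIntegrable G volume x y) (hc : ∀ᵐ s : ℝ, s ∈ Set.Ioo x y → c ≤ G s) :
    c * (y - x) ≤ ∫ s in x..y, G s := by
  have h1 : ∫ _ in x..y, c = c * (y - x) := by simp [mul_comm]
  rw [← h1]
  refine intervalIntegral.integral_mono_ae_restrict hxy (by simp) hG ?_
  rw [Filter.EventuallyLE, ← restrict_Ioo_eq_restrict_Icc, ae_restrict_iff' measurableSet_Ioo]
  exact hc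

/-- A strict lower bound at `x` of a function that is continuous on `[x, b]` is a lower bound of its
averages over short intervals to the right of `x`. -/
theorem eventually_mul_le_integral {G : ℝ → ℝ} {x b c : ℝ} (hxb : x < b)
    (hG : ContinuousOn G (Set.Icc x b)) (hc : c < G x) :
    ∀ᶠ h in 𝓝[>] (0 : ℝ), c * h ≤ ∫ s in x..x + h, G s := by
  have h1 : ∀ᶠ y in 𝓝[Set.Icc x b] x, c < G y :=
    (hG x (Set.left_mem_Icc.2 hxb.le)).eventually (lt_mem_nhds hc)
  have h2 : ∀ᶠ y in 𝓝[≥] x, y ∈ Set.Icc x b ∧ c < G y := by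
    rw [nhdsWithin_Icc_eq_nhdsGE hxb] at h1
    filter_upwards [h1, Icc_mem_nhdsGE hxb] with y hy hy' using ⟨hy', hy⟩
  obtain ⟨e, he, hes⟩ := mem_nhdsGE_iff_exists_Icc_subset.1 h2
  have h3 : ∀ᶠ z in 𝓝[>] x, z ≤ e := by
    filter_upwards [Ioc_mem_nhdsGT (show x < e from he)] with z hz using hz.2
  filter_upwards [(tendsto_const_add_nhdsGT_zero x).eventually h3, self_mem_nhdsWithin]
    with h hh hpos
  have hpos : 0 < h := hpos
  have := mul_le_integral_of_ae_le (G := G) (x := x) (y := x + h) (c := c) (by linarith)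
    (ContinuousOn.intervalIntegrable (by
      rw [Set.uIcc_of_le (by linarith)]
      exact hG.mono fun s hs => (hes ⟨hs.1, hs.2.trans hh⟩).1))
    (Eventually.of_forall fun s hs => (hes ⟨hs.1.le, hs.2.le.trans hh⟩).2.le)
  simpa using this

/-- A continuous function whose right difference quotients do not stay above any positive number
decreases. -/
theorem le_of_frequently_diff_lt {f : ℝ → ℝ} {a b : ℝ} (hab : a ≤ b)
    (hf : ContinuousOn f (Set.Icc a b))
    (h : ∀ x ∈ Set.Ico a b, ∀ r > 0, ∃ᶠ h in 𝓝[>] (0 : ℝ), f (x + h) - f x < r * h) :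
    f b ≤ f a := by
  have := le_gronwallBound_of_liminf_deriv_right_le (f' := fun _ => 0) (δ := f a) (K := 0) (ε := 0)
    hf (fun x hx r hr => ?_) le_rfl (fun _ _ => by simp) b (Set.right_mem_Icc.2 hab)
  · simpa [gronwallBound_K0] using this
  · refine (tendsto_const_add_nhdsGT_zero x).frequently ?_
    refine ((h x hx r hr).and_eventually self_mem_nhdsWithin).mono ?_
    rintro d ⟨hd, hpos⟩
    have hpos : 0 < d := hpos
    rw [add_sub_cancel_left, inv_mul_lt_iff₀ hpos]
    linarith [mul_comm r d]

/-- A null set is contained in the set where some lower semicontinuous function with arbitrarily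
small integral is infinite. -/
theorem exists_lowerSemicontinuous_eq_top {Z : Set ℝ} (hZ : volume Z = 0) {ε : ℝ} (hε : 0 < ε) :
    ∃ g : ℝ → ℝ≥0∞, LowerSemicontinuous g ∧ (∀ x ∈ Z, g x = ⊤) ∧
      Integrable (fun x => (g x).toReal) ∧ (∀ᵐ x, g x < ⊤) ∧ ∫ x, (g x).toReal ≤ ε := by
  obtain ⟨g, hg, hlsc, hint⟩ := exists_le_lowerSemicontinuous_lintegral_ge volume
    ((toMeasurable volume Z).indicator fun _ => (⊤ : ℝ≥0∞))
    (measurable_const.indicator (measurableSet_toMeasurable _ _))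
    (ε := ENNReal.ofReal ε) (by simpa using hε)
  have h0 : ∫⁻ x, (toMeasurable volume Z).indicator (fun _ => (⊤ : ℝ≥0∞)) x = 0 := by
    rw [lintegral_indicator (measurableSet_toMeasurable _ _)]
    simp [hZ]
  rw [h0, zero_add] at hint
  have hm : Measurable g := hlsc.measurable
  have hfin : ∫⁻ x, g x ≠ ⊤ := ne_top_of_le_ne_top ENNReal.ofReal_ne_top hint
  have hae : ∀ᵐ x, g x < ⊤ := ae_lt_top hm hfin
  refine ⟨g, hlsc, fun x hx => ?_, integrable_toReal_of_lintegral_ne_top hm.aemeasurable hfin,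
    hae, ?_⟩
  · have := hg x
    rw [Set.indicator_of_mem (subset_toMeasurable _ _ hx)] at this
    exact top_le_iff.1 this
  · rw [integral_toReal hm.aemeasurable hae]
    exact ENNReal.toReal_le_of_le_ofReal hε.le hint

theorem eventually_diff_lt_of_upperDini_lt {f : ℝ → ℝ} {x c : ℝ} (h : upperDini f x < (c : EReal)) :
    ∀ᶠ d in 𝓝[>] (0 : ℝ), f (x + d) - f x < c * d := by
  filter_upwards [eventually_lt_of_limsup_lt h, self_mem_nhdsWithin] with d hd hpos
  rw [EReal.coe_lt_coe_iff, div_lt_iff₀ hpos] at hd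
  exact hd

theorem frequently_diff_lt_of_lowerDini_lt {f : ℝ → ℝ} {x c : ℝ}
    (h : lowerDini f x < (c : EReal)) :
    ∃ᶠ d in 𝓝[>] (0 : ℝ), f (x + d) - f x < c * d := by
  refine ((frequently_lt_of_liminf_lt (by isBoundedDefault) h).and_eventually
    self_mem_nhdsWithin).mono ?_
  rintro d ⟨hd, hpos⟩
  rw [EReal.coe_lt_coe_iff, div_lt_iff₀ hpos] at hd
  exact hd

/-- A continuous function whose right upper Dini derivative is almost everywhere bounded by a
continuous function `g`, and whose right lower Dini derivative is nowhere `+∞`, grows at most by the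
integral of `g`. On the exceptional null set, the comparison function is made infinitely steep at
an arbitrarily small cost; this is where the condition on the lower derivative enters. -/
theorem sub_le_integral_of_upperDini_le {f g : ℝ → ℝ} {a b : ℝ} (hab : a ≤ b)
    (hf : ContinuousOn f (Set.Icc a b)) (hg : ContinuousOn g (Set.Icc a b))
    (hupper : ∀ᵐ x : ℝ, x ∈ Set.Ico a b → upperDini f x ≤ (g x : EReal))
    (hlower : ∀ x ∈ Set.Ico a b, lowerDini f x < ⊤) :
    f b - f a ≤ ∫ x in a..b, g x := by
  refine le_of_forall_pos_le_add fun ε hε => ?_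
  obtain ⟨G, hlsc, htop, hint, hae, hle⟩ :=
    exists_lowerSemicontinuous_eq_top (ae_iff.1 hupper) hε
  set τ : ℝ → ℝ := fun x => (G x).toReal with hτ
  have hgi : ∀ {x y}, x ∈ Set.Icc a b → y ∈ Set.Icc a b → IntervalIntegrable g volume x y :=
    fun {x y} hx hy =>
      (hg.mono (Set.OrdConnected.uIcc_subset Set.ordConnected_Icc hx hy)).intervalIntegrable
  have hτi : ∀ x y, IntervalIntegrable τ volume x y := fun x y => hint.intervalIntegrable
  have ha : a ∈ Set.Icc a b := Set.left_mem_Icc.2 hab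
  have hb : b ∈ Set.Icc a b := Set.right_mem_Icc.2 hab
  have key := le_of_frequently_diff_lt
    (f := fun x => f x - (∫ s in a..x, g s) - ∫ s in a..x, τ s) hab ?_ ?_
  · have h1 : ∫ s in a..b, τ s ≤ ε := by
      rw [intervalIntegral.integral_of_le hab]
      exact (setIntegral_le_integral hint
        (Eventually.of_forall fun _ => ENNReal.toReal_nonneg)).trans hle
    simp only [intervalIntegral.integral_same] at key
    linarith
  · have e : Set.uIcc a b = Set.Icc a b := Set.uIcc_of_le hab
    refine (hf.sub ?_).sub ?_
    · rw [← e]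
      refine intervalIntegral.continuousOn_primitive_interval ?_
      rw [e]
      exact hg.integrableOn_Icc
    · rw [← e]
      exact intervalIntegral.continuousOn_primitive_interval hint.integrableOn
  · intro x hx r hr
    have hxI : x ∈ Set.Icc a b := ⟨hx.1, hx.2.le⟩
    have hgev := eventually_mul_le_integral (c := g x - r / 2) hx.2
      (hg.mono (Set.Icc_subset_Icc_left hx.1)) (by linarith)
    have hsmall : ∀ᶠ d in 𝓝[>] (0 : ℝ), 0 < d ∧ x + d ∈ Set.Icc a b := by
      filter_upwards [self_mem_nhdsWithin,
        (tendsto_const_add_nhdsGT_zero x).eventually (Ioo_mem_nhdsGT hx.2)] with d hd hd'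
      exact ⟨hd, hx.1.trans hd'.1.le, hd'.2.le⟩
    suffices h : ∃ᶠ d in 𝓝[>] (0 : ℝ),
        f (x + d) - f x - (∫ s in x..x + d, τ s) < (g x + r / 2) * d by
      refine (h.and_eventually (hgev.and hsmall)).mono ?_
      rintro d ⟨h1, h2, hpos, hd⟩
      rw [← intervalIntegral.integral_add_adjacent_intervals (hgi ha hxI) (hgi hxI hd),
        ← intervalIntegral.integral_add_adjacent_intervals (hτi a x) (hτi x (x + d))]
      linarith
    by_cases hxZ : upperDini f x ≤ (g x : EReal)
    · have h1 := eventually_diff_lt_of_upperDini_lt (c := g x + r / 2)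
        (lt_of_le_of_lt hxZ (EReal.coe_lt_coe_iff.2 (by linarith)))
      refine (h1.and hsmall).frequently.mono ?_
      rintro d ⟨h2, hpos, -⟩
      have : 0 ≤ ∫ s in x..x + d, τ s :=
        intervalIntegral.integral_nonneg (by linarith) fun _ _ => ENNReal.toReal_nonneg
      linarith
    · obtain ⟨M, hM⟩ := EReal.lt_iff_exists_real_btwn.1 (hlower x hx)
      have h1 := frequently_diff_lt_of_lowerDini_lt hM.1
      -- near `x`, the function `τ` exceeds `K`, the slope needed to compensate `M`
      set K : ℝ := M - g x with hK
      have hGx : ENNReal.ofReal K < G x := by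
        rw [htop x (by simpa [hx.1, hx.2] using hxZ)]
        exact ENNReal.ofReal_lt_top
      have h2 : ∀ᶠ y in 𝓝[≥] x, ENNReal.ofReal K < G y :=
        (hlsc x _ hGx).filter_mono nhdsWithin_le_nhds
      obtain ⟨e, he, hes⟩ := mem_nhdsGE_iff_exists_Icc_subset.1 h2
      have h3 : ∀ᶠ z in 𝓝[>] x, z ≤ e := by
        filter_upwards [Ioc_mem_nhdsGT (show x < e from he)] with z hz using hz.2
      refine (h1.and_eventually
        (((tendsto_const_add_nhdsGT_zero x).eventually h3).and hsmall)).mono ?_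
      rintro d ⟨h4, h5, hpos, -⟩
      have h6 := mul_le_integral_of_ae_le (c := K) (x := x) (y := x + d) (by linarith)
        (hτi x (x + d)) (by
          filter_upwards [hae] with s hs hsI
          have : ENNReal.ofReal K < G s := hes ⟨hsI.1.le, hsI.2.le.trans h5⟩
          exact (ENNReal.ofReal_le_iff_le_toReal hs.ne).1 this.le)
      rw [add_sub_cancel_left, hK, sub_mul] at h6
      have : 0 < r / 2 * d := by positivity
      rw [add_mul]
      linarith

/-! ### Weights from the small-gain condition -/

theorem exists_norm_pow_lt_one {A : Type*} [NormedRing A] [NormedAlgebra ℂ A] [CompleteSpace A]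
    {a : A} (ha : spectralRadius ℂ a < 1) : ∃ n, ‖a ^ n‖ < 1 := by
  have h := (spectrum.pow_nnnorm_pow_one_div_tendsto_nhds_spectralRadius a).eventually
    (gt_mem_nhds ha)
  obtain ⟨n, hn, hpos⟩ := (h.and (eventually_gt_atTop 0)).exists
  refine ⟨n, ?_⟩
  by_contra! hge
  refine hn.not_ge ?_
  have : (1 : ℝ≥0∞) ≤ ‖a ^ n‖₊ := by
    rw [ENNReal.one_le_coe_iff]
    exact hge
  exact ENNReal.one_le_rpow this (by positivity)

/-- The row vector `(1, 1, …) ψᵏ`, whose entries are the column sums of the `k`-th power of the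
nonnegative matrix `ψ`. -/
noncomputable def powColSum (ψ : ℕ → ℕ → ℝ≥0∞) : ℕ → ℕ → ℝ≥0∞
  | 0, _ => 1
  | k + 1, j => ∑' i, powColSum ψ k i * ψ i j

/-- For a nonnegative matrix and a nonnegative `x`, the norm of `Sᵏ x` in `ℓ¹` is the sum of its
entries, which is the pairing of `x` with the column sums of the `k`-th power. -/
theorem tsum_powColSum_mul {ψ : ℕ → ℕ → ℝ≥0} {S : lp (fun _ : ℕ => ℂ) 1 →L[ℂ] lp (fun _ : ℕ => ℂ) 1}
    (hS : IsMatrixOperator (fun i j => (ψ i j : ℝ)) S) (k : ℕ) :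
    ∀ (x : lp (fun _ : ℕ => ℂ) 1) (c : ℕ → ℝ≥0), (∀ j, x j = ((c j : ℝ) : ℂ)) →
      ∑' j, powColSum (fun i j => (ψ i j : ℝ≥0∞)) k j * c j = ENNReal.ofReal ‖(S ^ k) x‖ := by
  induction k with
  | zero =>
    intro x c hx
    have h := lp.hasSum_norm (p := 1) (by simp) x
    simp only [ENNReal.toReal_one, Real.rpow_one, hx, Complex.norm_real, Real.norm_eq_abs,
      NNReal.abs_eq] at h
    have h2 : ‖x‖ = ((∑' j, c j : ℝ≥0) : ℝ) := by
      rw [← h.tsum_eq, NNReal.coe_tsum]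
    simp only [powColSum, one_mul, pow_zero, one_apply_eq_self]
    rw [h2, ENNReal.ofReal_coe_nnreal, ENNReal.coe_tsum (NNReal.summable_coe.1 h.summable)]
  | succ k ih =>
    intro x c hx
    have hsum : ∀ i, HasSum (fun j => ((ψ i j * c j : ℝ≥0) : ℂ)) (S x i) := by
      intro i
      have := hS x i
      simpa [hx] using this
    have hsm : ∀ i, Summable fun j => ψ i j * c j := by
      intro i
      have h1 : Summable fun j => ((ψ i j * c j : ℝ≥0) : ℝ) := by
        simpa using (hsum i).summable.norm
      exact NNReal.summable_coe.1 h1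
    have hSx : ∀ i, S x i = (((∑' j, ψ i j * c j : ℝ≥0) : ℝ) : ℂ) := by
      intro i
      refine (hsum i).unique ?_
      have := (NNReal.hasSum_coe.2 (hsm i).hasSum)
      simpa using Complex.hasSum_ofReal.2 this
    have h1 := ih (S x) _ hSx
    rw [pow_succ, mul_apply_eq_comp, ← h1]
    simp only [powColSum, ← ENNReal.tsum_mul_right]
    rw [ENNReal.tsum_comm]
    refine tsum_congr fun i => ?_
    rw [ENNReal.coe_tsum (hsm i), ← ENNReal.tsum_mul_left]
    refine tsum_congr fun j => ?_
    rw [ENNReal.coe_mul, mul_assoc]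

theorem powColSum_le {ψ : ℕ → ℕ → ℝ≥0} {S : lp (fun _ : ℕ => ℂ) 1 →L[ℂ] lp (fun _ : ℕ => ℂ) 1}
    (hS : IsMatrixOperator (fun i j => (ψ i j : ℝ)) S) (k j : ℕ) :
    powColSum (fun i j => (ψ i j : ℝ≥0∞)) k j ≤ ENNReal.ofReal ‖S ^ k‖ := by
  have h := tsum_powColSum_mul hS k (lp.single 1 j (1 : ℂ)) (Pi.single j 1) (by
    intro i
    by_cases hij : i = j
    · subst hij; simp
    · simp [hij])
  rw [tsum_eq_single j (by intro i hi; simp [hi])] at h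
  simp only [Pi.single_eq_same, ENNReal.coe_one, mul_one] at h
  rw [h]
  refine ENNReal.ofReal_le_ofReal ?_
  refine ((S ^ k).le_opNorm _).trans ?_
  rw [lp.norm_single (by simp)]
  simp

/-- A nonnegative matrix with spectral radius less than one on `ℓ¹` has a bounded
nonnegative row vector `ν` with `ν ψ ≤ ν - δ` for a constant `δ > 0`: the truncated Neumann
series applied to `(1, 1, …)`. -/
theorem exists_subinvariant_row {ψ : ℕ → ℕ → ℝ≥0}
    {S : lp (fun _ : ℕ => ℂ) 1 →L[ℂ] lp (fun _ : ℕ => ℂ) 1}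
    (hS : IsMatrixOperator (fun i j => (ψ i j : ℝ)) S) (hr : spectralRadius ℂ S < 1) :
    ∃ (ν : ℕ → ℝ) (C δ : ℝ), 0 < δ ∧ (∀ j, 0 ≤ ν j) ∧ (∀ j, ν j ≤ C) ∧
      ∀ (s : Finset ℕ) (j : ℕ), ∑ i ∈ s, ν i * ψ i j ≤ ν j - δ := by
  obtain ⟨n, hlt⟩ := exists_norm_pow_lt_one hr
  set ψ' : ℕ → ℕ → ℝ≥0∞ := fun i j => (ψ i j : ℝ≥0∞) with hψ'
  have hwle : ∀ k j, powColSum ψ' k j ≤ ENNReal.ofReal ‖S ^ k‖ := powColSum_le hS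
  have hwtop : ∀ k j, powColSum ψ' k j ≠ ⊤ := fun k j =>
    ne_top_of_le_ne_top ENNReal.ofReal_ne_top (hwle k j)
  have hwreal : ∀ k j, (powColSum ψ' k j).toReal ≤ ‖S ^ k‖ := fun k j =>
    ENNReal.toReal_le_of_le_ofReal (norm_nonneg _) (hwle k j)
  refine ⟨fun j => ∑ k ∈ Finset.range n, (powColSum ψ' k j).toReal,
    ∑ k ∈ Finset.range n, ‖S ^ k‖, 1 - ‖S ^ n‖, by linarith,
    fun j => Finset.sum_nonneg fun _ _ => ENNReal.toReal_nonneg,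
    fun j => Finset.sum_le_sum fun k _ => hwreal k j, fun s j => ?_⟩
  have hstep : ∀ k, ∑ i ∈ s, (powColSum ψ' k i).toReal * ψ i j ≤
      (powColSum ψ' (k + 1) j).toReal := by
    intro k
    have h1 : ∑ i ∈ s, powColSum ψ' k i * ψ' i j ≤ powColSum ψ' (k + 1) j :=
      ENNReal.sum_le_tsum s
    have h2 := ENNReal.toReal_mono (hwtop (k + 1) j) h1
    rw [ENNReal.toReal_sum (fun i _ => ENNReal.mul_ne_top (hwtop k i) ENNReal.coe_ne_top)] at h2
    simpa [hψ', ENNReal.toReal_mul] using h2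
  have htel : ∑ k ∈ Finset.range n, (powColSum ψ' (k + 1) j).toReal
      = ∑ k ∈ Finset.range n, (powColSum ψ' k j).toReal + (powColSum ψ' n j).toReal - 1 := by
    have h1 := Finset.sum_range_succ' (fun k => (powColSum ψ' k j).toReal) n
    rw [Finset.sum_range_succ] at h1
    simp only [powColSum, ENNReal.toReal_one] at h1 ⊢
    linarith
  calc ∑ i ∈ s, (∑ k ∈ Finset.range n, (powColSum ψ' k i).toReal) * ψ i j
      = ∑ k ∈ Finset.range n, ∑ i ∈ s, (powColSum ψ' k i).toReal * ψ i j := by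
        rw [Finset.sum_comm]
        simp only [Finset.sum_mul]
    _ ≤ ∑ k ∈ Finset.range n, (powColSum ψ' (k + 1) j).toReal :=
        Finset.sum_le_sum fun k _ => hstep k
    _ ≤ _ := by
        rw [htel]
        linarith [hwreal n j]

/-- The weights of the composite Lyapunov function. They form a uniformly positive and bounded
row vector `μ` with `μ Γ ≤ μ (Λ - κ)`. The decay rates `lam i` need not be bounded above, so that
`ν i / lam i` may tend to zero; the boundedness of `Γ` allows a small constant to be added to it. -/
theorem exists_weights {lam : ℕ → ℝ} {γ : ℕ → ℕ → ℝ} {lamlow : ℝ} (hlow : 0 < lamlow)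
    (hlam : ∀ i, lamlow ≤ lam i) (hγ : ∀ i j, 0 ≤ γ i j)
    (hΓ : (⨆ j, ∑' i, ENNReal.ofReal (γ i j)) < ⊤)
    {S : lp (fun _ : ℕ => ℂ) 1 →L[ℂ] lp (fun _ : ℕ => ℂ) 1}
    (hS : IsMatrixOperator (fun i j => γ i j / lam i) S) (hr : spectralRadius ℂ S < 1) :
    ∃ (μ : ℕ → ℝ) (μlow μup κ K : ℝ), 0 < μlow ∧ 0 < κ ∧ 0 ≤ K ∧
      (∀ i, μlow ≤ μ i ∧ μ i ≤ μup) ∧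
      (∀ (s : Finset ℕ) (j : ℕ), ∑ i ∈ s, μ i * γ i j ≤ μ j * (lam j - κ)) ∧
      ∀ (s : Finset ℕ) (j : ℕ), ∑ i ∈ s, μ i * γ i j ≤ K * μ j := by
  have hlam0 : ∀ i, 0 < lam i := fun i => hlow.trans_le (hlam i)
  obtain ⟨ν, C, δ, hδ, hν0, hνC, hν⟩ := exists_subinvariant_row
    (ψ := fun i j => ⟨γ i j / lam i, div_nonneg (hγ i j) (hlam0 i).le⟩) hS hr
  have hC : 0 ≤ C := (hν0 0).trans (hνC 0)
  set G : ℝ := (⨆ j, ∑' i, ENNReal.ofReal (γ i j)).toReal with hG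
  have hG0 : 0 ≤ G := ENNReal.toReal_nonneg
  have hcol : ∀ (s : Finset ℕ) (j : ℕ), ∑ i ∈ s, γ i j ≤ G := by
    intro s j
    have h1 : ∑ i ∈ s, ENNReal.ofReal (γ i j) ≤ ⨆ j, ∑' i, ENNReal.ofReal (γ i j) :=
      (ENNReal.sum_le_tsum s).trans (le_iSup (fun j => ∑' i, ENNReal.ofReal (γ i j)) j)
    rw [← ENNReal.ofReal_sum_of_nonneg fun i _ => hγ i j] at h1
    exact (ENNReal.ofReal_le_iff_le_toReal hΓ.ne).1 h1
  set ε : ℝ := δ / (2 * (G + 1)) with hε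
  have hε0 : 0 < ε := by positivity
  have hεG : ε * G ≤ δ / 2 := by
    rw [hε, div_mul_eq_mul_div, div_le_div_iff₀ (by positivity) (by positivity)]
    nlinarith
  set μup : ℝ := C / lamlow + ε with hμup
  have hup0 : 0 < μup := by positivity
  set κ : ℝ := δ / 2 / μup with hκ
  have hμle : ∀ i, ν i / lam i + ε ≤ μup := by
    intro i
    have : ν i / lam i ≤ C / lamlow := div_le_div₀ hC (hνC i) hlow (hlam i)
    linarith
  have hμge : ∀ i, ε ≤ ν i / lam i + ε := fun i => by
    have := div_nonneg (hν0 i) (hlam0 i).le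
    linarith
  refine ⟨fun i => ν i / lam i + ε, ε, μup, κ, μup * G / ε, hε0, by positivity, by positivity,
    fun i => ⟨hμge i, hμle i⟩, fun s j => ?_, fun s j => ?_⟩
  · have h1 : ∑ i ∈ s, (ν i / lam i + ε) * γ i j
        = ∑ i ∈ s, ν i * (γ i j / lam i) + ε * ∑ i ∈ s, γ i j := by
      rw [Finset.mul_sum, ← Finset.sum_add_distrib]
      exact Finset.sum_congr rfl fun i _ => by ring
    have h2 : ∑ i ∈ s, ν i * (γ i j / lam i) ≤ ν j - δ := hν s j
    have h3 : ε * ∑ i ∈ s, γ i j ≤ ε * G := mul_le_mul_of_nonneg_left (hcol s j) hε0.le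
    have h4 : κ * (ν j / lam j + ε) ≤ δ / 2 := by
      rw [hκ, div_mul_eq_mul_div, div_le_iff₀ hup0]
      exact mul_le_mul_of_nonneg_left (hμle j) (by positivity)
    have h5 : (ν j / lam j + ε) * (lam j - κ)
        = ν j + ε * lam j - κ * (ν j / lam j + ε) := by
      have := (hlam0 j).ne'
      field_simp
    have h6 : 0 ≤ ε * lam j := mul_nonneg hε0.le (hlam0 j).le
    rw [h1, h5]
    linarith
  · calc ∑ i ∈ s, (ν i / lam i + ε) * γ i j ≤ ∑ i ∈ s, μup * γ i j :=
          Finset.sum_le_sum fun i _ => mul_le_mul_of_nonneg_right (hμle i) (hγ i j)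
      _ ≤ μup * G := by
          rw [← Finset.mul_sum]
          exact mul_le_mul_of_nonneg_left (hcol s j) hup0.le
      _ = μup * G / ε * ε := by field_simp
      _ ≤ μup * G / ε * (ν j / lam j + ε) :=
          mul_le_mul_of_nonneg_left (hμge j) (by positivity)

/-! ### Summation of the dissipative estimates -/

/-- Weighted sum of the first `n` right-hand sides of the dissipative estimates. The neighbours with
index at least `n` contribute only a multiple of the tail of `∑ μ i * v i`. -/
theorem sum_weighted_rhs_le {μ lam v : ℕ → ℝ} {γ : ℕ → ℕ → ℝ} {nbr : ℕ → Finset ℕ} {κ K w : ℝ}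
    (hγzero : ∀ i, ∀ j ∉ nbr i, γ i j = 0) (hK : 0 ≤ K)
    (hκsum : ∀ (s : Finset ℕ) (j : ℕ), ∑ i ∈ s, μ i * γ i j ≤ μ j * (lam j - κ))
    (hKsum : ∀ (s : Finset ℕ) (j : ℕ), ∑ i ∈ s, μ i * γ i j ≤ K * μ j)
    (hμ : ∀ i, 0 ≤ μ i) (hv : ∀ i, 0 ≤ v i) (hw : HasSum (fun i => μ i * v i) w) (n : ℕ) :
    ∑ i ∈ Finset.range n, μ i * (-lam i * v i + ∑ j ∈ nbr i, γ i j * v j) ≤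
      -κ * (∑ i ∈ Finset.range n, μ i * v i) +
        K * (w - ∑ i ∈ Finset.range n, μ i * v i) := by
  classical
  set s := Finset.range n with hs
  set J : Finset ℕ := s.biUnion nbr with hJ
  have h1 : ∀ i ∈ s, ∑ j ∈ nbr i, γ i j * v j = ∑ j ∈ s ∪ J, γ i j * v j := by
    intro i hi
    refine Finset.sum_subset (fun j hj => Finset.mem_union_right _
      (Finset.mem_biUnion.2 ⟨i, hi, hj⟩)) fun j _ hj => ?_
    rw [hγzero i j hj, zero_mul]
  have h2 : ∑ i ∈ s, μ i * (∑ j ∈ nbr i, γ i j * v j)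
      = ∑ j ∈ s ∪ J, (∑ i ∈ s, μ i * γ i j) * v j := by
    rw [Finset.sum_congr rfl fun i hi => by rw [h1 i hi]]
    simp only [Finset.mul_sum, Finset.sum_mul]
    rw [Finset.sum_comm]
    exact Finset.sum_congr rfl fun j _ => Finset.sum_congr rfl fun i _ => by ring
  have h3 : ∑ j ∈ s ∪ J, (∑ i ∈ s, μ i * γ i j) * v j
      = ∑ j ∈ (s ∪ J) \ s, (∑ i ∈ s, μ i * γ i j) * v j + ∑ j ∈ s, (∑ i ∈ s, μ i * γ i j) * v j :=
    (Finset.sum_sdiff Finset.subset_union_left).symm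
  have h4 : ∑ j ∈ s, (∑ i ∈ s, μ i * γ i j) * v j ≤ ∑ j ∈ s, μ j * (lam j - κ) * v j :=
    Finset.sum_le_sum fun j _ => mul_le_mul_of_nonneg_right (hκsum s j) (hv j)
  have h5 : ∑ j ∈ (s ∪ J) \ s, (∑ i ∈ s, μ i * γ i j) * v j
      ≤ K * ∑ j ∈ (s ∪ J) \ s, μ j * v j := by
    rw [Finset.mul_sum]
    refine Finset.sum_le_sum fun j _ => ?_
    rw [← mul_assoc]
    exact mul_le_mul_of_nonneg_right (hKsum s j) (hv j)
  have h6 : ∑ j ∈ (s ∪ J) \ s, μ j * v j ≤ w - ∑ i ∈ s, μ i * v i := by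
    have := sum_le_hasSum (s ∪ J) (fun i _ => mul_nonneg (hμ i) (hv i)) hw
    rw [← Finset.sum_sdiff (Finset.subset_union_left (s₁ := s) (s₂ := J))] at this
    linarith
  have h7 := mul_le_mul_of_nonneg_left h6 hK
  have h8 : ∑ i ∈ s, μ i * (-lam i * v i + ∑ j ∈ nbr i, γ i j * v j)
      = ∑ i ∈ s, μ i * (-lam i) * v i + ∑ i ∈ s, μ i * (∑ j ∈ nbr i, γ i j * v j) := by
    rw [← Finset.sum_add_distrib]
    exact Finset.sum_congr rfl fun i _ => by ring
  have h9 : ∑ i ∈ s, μ i * (-lam i) * v i + ∑ j ∈ s, μ j * (lam j - κ) * v j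
      = -κ * ∑ i ∈ s, μ i * v i := by
    rw [Finset.mul_sum, ← Finset.sum_add_distrib]
    exact Finset.sum_congr rfl fun i _ => by ring
  rw [h8, h2, h3]
  linarith

/-- Summing the integrated dissipative estimates with the weights `μ`. The partial sums are treated
first, because `∑ μ i * lam i * v i` may diverge; the tails vanish by dominated convergence. -/
theorem weighted_sum_sub_le_integral {μ lam : ℕ → ℝ} {γ : ℕ → ℕ → ℝ} {nbr : ℕ → Finset ℕ}
    {κ K a b : ℝ} {v : ℕ → ℝ → ℝ} {w : ℝ → ℝ} (hab : a ≤ b)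
    (hγzero : ∀ i, ∀ j ∉ nbr i, γ i j = 0) (hκ : 0 ≤ κ) (hK : 0 ≤ K)
    (hκsum : ∀ (s : Finset ℕ) (j : ℕ), ∑ i ∈ s, μ i * γ i j ≤ μ j * (lam j - κ))
    (hKsum : ∀ (s : Finset ℕ) (j : ℕ), ∑ i ∈ s, μ i * γ i j ≤ K * μ j)
    (hμ : ∀ i, 0 ≤ μ i) (hv : ∀ i t, 0 ≤ v i t)
    (hvc : ∀ i, ContinuousOn (v i) (Set.Icc a b)) (hwc : ContinuousOn w (Set.Icc a b))
    (hw : ∀ t, HasSum (fun i => μ i * v i t) (w t))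
    (hest : ∀ i, v i b - v i a ≤ ∫ t in a..b, (-lam i * v i t + ∑ j ∈ nbr i, γ i j * v j t)) :
    w b - w a ≤ ∫ t in a..b, -κ * w t := by
  have hII : ∀ {f : ℝ → ℝ}, ContinuousOn f (Set.Icc a b) → IntervalIntegrable f volume a b := by
    intro f hf
    refine ContinuousOn.intervalIntegrable ?_
    rwa [Set.uIcc_of_le hab]
  set S : ℕ → ℝ → ℝ := fun n t => ∑ i ∈ Finset.range n, μ i * v i t with hS
  have hSc : ∀ n, ContinuousOn (S n) (Set.Icc a b) := fun n =>
    continuousOn_finsetSum _ fun i _ => continuousOn_const.mul (hvc i)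
  have hrc : ∀ i, ContinuousOn (fun t => -lam i * v i t + ∑ j ∈ nbr i, γ i j * v j t)
      (Set.Icc a b) := fun i =>
    (continuousOn_const.mul (hvc i)).add
      (continuousOn_finsetSum _ fun j _ => continuousOn_const.mul (hvc j))
  have hFc : ∀ n, ContinuousOn (fun t => -κ * S n t + K * (w t - S n t)) (Set.Icc a b) := fun n =>
    (continuousOn_const.mul (hSc n)).add (continuousOn_const.mul (hwc.sub (hSc n)))
  have hS0 : ∀ n t, 0 ≤ S n t := fun n t =>
    Finset.sum_nonneg fun i _ => mul_nonneg (hμ i) (hv i t)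
  have hSw : ∀ n t, S n t ≤ w t := fun n t =>
    sum_le_hasSum _ (fun i _ => mul_nonneg (hμ i) (hv i t)) (hw t)
  have hpart : ∀ n, S n b - S n a ≤ ∫ t in a..b, (-κ * S n t + K * (w t - S n t)) := by
    intro n
    calc S n b - S n a = ∑ i ∈ Finset.range n, μ i * (v i b - v i a) := by
          simp only [hS, ← Finset.sum_sub_distrib, mul_sub]
      _ ≤ ∑ i ∈ Finset.range n,
            μ i * ∫ t in a..b, (-lam i * v i t + ∑ j ∈ nbr i, γ i j * v j t) :=
          Finset.sum_le_sum fun i _ => mul_le_mul_of_nonneg_left (hest i) (hμ i)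
      _ = ∫ t in a..b, ∑ i ∈ Finset.range n,
            μ i * (-lam i * v i t + ∑ j ∈ nbr i, γ i j * v j t) := by
          rw [intervalIntegral.integral_finsetSum
            (f := fun i t => μ i * (-lam i * v i t + ∑ j ∈ nbr i, γ i j * v j t))
            fun i _ => hII (continuousOn_const.mul (hrc i))]
          simp only [intervalIntegral.integral_const_mul]
      _ ≤ _ := by
          refine intervalIntegral.integral_mono_on hab
            (hII (continuousOn_finsetSum _ fun i _ => continuousOn_const.mul (hrc i)))
            (hII (hFc n)) fun t _ => ?_
          exact sum_weighted_rhs_le hγzero hK hκsum hKsum hμ (fun i => hv i t) (hw t) n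
  have hlimS : ∀ t, Tendsto (fun n => S n t) atTop (𝓝 (w t)) := fun t => (hw t).tendsto_sum_nat
  have hlim : Tendsto (fun n => ∫ t in a..b, (-κ * S n t + K * (w t - S n t))) atTop
      (𝓝 (∫ t in a..b, -κ * w t)) := by
    refine intervalIntegral.tendsto_integral_filter_of_dominated_convergence
      (fun t => (κ + K) * w t) ?_ ?_ (hII (continuousOn_const.mul hwc)) ?_
    · exact Eventually.of_forall fun n =>
        (intervalIntegrable_iff.1 (hII (hFc n))).aestronglyMeasurable
    · refine Eventually.of_forall fun n => Eventually.of_forall fun t _ => ?_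
      have h1 := mul_nonneg hκ (hS0 n t)
      have h2 := mul_nonneg hK (sub_nonneg.2 (hSw n t))
      have h3 := mul_le_mul_of_nonneg_left (hSw n t) hκ
      have h4 := mul_nonneg hK (hS0 n t)
      rw [Real.norm_eq_abs, abs_le]
      constructor <;> nlinarith
    · refine Eventually.of_forall fun t _ => ?_
      have := ((hlimS t).const_mul (-κ)).add (((hlimS t).const_sub (w t)).const_mul K)
      simpa using this
  exact le_of_tendsto_of_tendsto' ((hlimS b).sub (hlimS a)) hlim hpart

/-- The integral inequality with decay rate `κ` bounds the slopes to the right of the initial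
time. -/
theorem eventually_diff_le_of_integral_decay {w : ℝ → ℝ} {κ x b r : ℝ} (hxb : x < b)
    (hwc : ContinuousOn w (Set.Icc x b))
    (hw : ∀ t ∈ Set.Icc x b, w t - w x ≤ ∫ s in x..t, -κ * w s) (hr : -κ * w x < r) :
    ∀ᶠ h in 𝓝[>] (0 : ℝ), w (x + h) - w x ≤ r * h := by
  have h1 := eventually_mul_le_integral (G := fun s => κ * w s) (c := -r) hxb
    (continuousOn_const.mul hwc) (by linarith)
  filter_upwards [h1, (tendsto_const_add_nhdsGT_zero x).eventually (Ioo_mem_nhdsGT hxb)]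
    with h hh hI
  have h2 := hw (x + h) ⟨hI.1.le, hI.2.le⟩
  simp only [neg_mul, intervalIntegral.integral_neg] at h2
  linarith

/-- The integral inequality with decay rate `κ` implies exponential decay. -/
theorem le_mul_exp_of_integral_decay {w : ℝ → ℝ} {κ a b : ℝ} (hab : a ≤ b)
    (hwc : ContinuousOn w (Set.Icc a b))
    (hw : ∀ x ∈ Set.Icc a b, ∀ t ∈ Set.Icc x b, w t - w x ≤ ∫ s in x..t, -κ * w s) :
    w b ≤ w a * Real.exp (-κ * (b - a)) := by
  have := le_gronwallBound_of_liminf_deriv_right_le (f' := fun x => -κ * w x) (δ := w a)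
    (K := -κ) (ε := 0) hwc (fun x hx r hr => ?_) le_rfl (fun _ _ => by simp) b
    (Set.right_mem_Icc.2 hab)
  · simpa [gronwallBound_ε0] using this
  · obtain ⟨r', hr1, hr2⟩ := exists_between hr
    refine (tendsto_const_add_nhdsGT_zero x).frequently ?_
    refine ((eventually_diff_le_of_integral_decay hx.2
      (hwc.mono (Set.Icc_subset_Icc_left hx.1)) (hw x ⟨hx.1, hx.2.le⟩) hr1).and
      self_mem_nhdsWithin).frequently.mono ?_
    rintro d ⟨hd, hpos⟩
    have hpos : 0 < d := hpos
    rw [add_sub_cancel_left, inv_mul_lt_iff₀ hpos]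
    nlinarith

theorem upperDini_zero_le_of_integral_decay {w : ℝ → ℝ} {κ b : ℝ} (hb : 0 < b)
    (hwc : ContinuousOn w (Set.Icc 0 b))
    (hw : ∀ t ∈ Set.Icc 0 b, w t - w 0 ≤ ∫ s in (0 : ℝ)..t, -κ * w s) :
    upperDini w 0 ≤ ((-κ * w 0 : ℝ) : EReal) := by
  refine EReal.le_of_forall_lt_iff_le.1 fun r hr => ?_
  refine limsup_le_of_le (by isBoundedDefault) ?_
  filter_upwards [eventually_diff_le_of_integral_decay hb hwc hw (EReal.coe_lt_coe_iff.1 hr),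
    self_mem_nhdsWithin] with h hh hpos
  rw [EReal.coe_le_coe_iff, div_le_iff₀ hpos]
  exact hh

/-! ### Continuity of the composite function and the distance to the diagonal -/

/-- A series of continuous functions is continuous if it is dominated by a series of continuous
functions whose sum is continuous. -/
theorem continuous_of_hasSum_of_le {Z : Type*} [TopologicalSpace Z] {F B : ℕ → Z → ℝ} {w b : Z → ℝ}
    (hF : ∀ i, Continuous (F i)) (hB : ∀ i, Continuous (B i)) (hb : Continuous b)
    (h0 : ∀ i z, 0 ≤ F i z) (hle : ∀ i z, F i z ≤ B i z)
    (hFw : ∀ z, HasSum (fun i => F i z) (w z)) (hBb : ∀ z, HasSum (fun i => B i z) (b z)) :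
    Continuous w := by
  have htail : ∀ (n : ℕ) z, |w z - ∑ i ∈ Finset.range n, F i z| ≤
      b z - ∑ i ∈ Finset.range n, B i z := by
    intro n z
    have h1 := sum_le_hasSum (Finset.range n) (fun i _ => h0 i z) (hFw z)
    have h2 := sum_le_hasSum (Finset.range n) (fun i _ => sub_nonneg.2 (hle i z))
      ((hBb z).sub (hFw z))
    rw [Finset.sum_sub_distrib] at h2
    rw [abs_of_nonneg (sub_nonneg.2 h1)]
    linarith
  refine continuous_iff_continuousAt.2 fun z => Metric.tendsto_nhds.2 fun ε hε => ?_
  obtain ⟨n, hn⟩ := ((hBb z).tendsto_sum_nat.eventually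
    (lt_mem_nhds (show b z - ε / 3 < b z by linarith))).exists
  have hcB : Continuous fun y => b y - ∑ i ∈ Finset.range n, B i y :=
    hb.sub (continuous_finsetSum _ fun i _ => hB i)
  have hcF : Continuous fun y => ∑ i ∈ Finset.range n, F i y :=
    continuous_finsetSum _ fun i _ => hF i
  filter_upwards [hcB.continuousAt.eventually (gt_mem_nhds
      (show b z - ∑ i ∈ Finset.range n, B i z < ε / 3 by linarith)),
    Metric.tendsto_nhds.1 (hcF.tendsto z) (ε / 3) (by positivity)] with y hy1 hy2
  have h1 := abs_le.1 (htail n y)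
  have h2 := abs_le.1 (htail n z)
  rw [Real.dist_eq] at hy2 ⊢
  have h3 := abs_lt.1 hy2
  rw [abs_lt]
  constructor <;> linarith

section

variable {E : ℕ → Type*} [∀ i, NormedAddCommGroup (E i)] {p : ℝ≥0∞} [Fact (1 ≤ p)]

theorem continuous_fst_coord (i : ℕ) : Continuous fun z : CompositeState E p => z.fst i :=
  (lp.lipschitzWith_one_eval p i).continuous.comp (WithLp.continuous_fst 2 _ _)

theorem continuous_snd_coord (i : ℕ) : Continuous fun z : CompositeState E p => z.snd i :=
  (lp.lipschitzWith_one_eval p i).continuous.comp (WithLp.continuous_snd 2 _ _)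

theorem continuous_norm_error : Continuous fun z : CompositeState E p => ‖z.fst - z.snd‖ :=
  ((WithLp.continuous_fst 2 _ _).sub (WithLp.continuous_snd 2 _ _)).norm

theorem infDist_diagonalSet_le (z : CompositeState E p) :
    Metric.infDist z (diagonalSet E p) ≤ ‖z.fst - z.snd‖ := by
  have hmem : (WithLp.toLp 2 (z.snd, z.snd) : CompositeState E p) ∈ diagonalSet E p := rfl
  refine (Metric.infDist_le_dist_of_mem hmem).trans ?_
  rw [dist_eq_norm, WithLp.prod_norm_eq_of_L2]
  simp

theorem norm_error_le (z : CompositeState E p) :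
    ‖z.fst - z.snd‖ ≤ √2 * Metric.infDist z (diagonalSet E p) := by
  have hne : (diagonalSet E p).Nonempty := ⟨0, rfl⟩
  have h2 : (0 : ℝ) < √2 := by positivity
  rw [← div_le_iff₀' h2, Metric.le_infDist hne]
  intro y hy
  have hy : y.fst = y.snd := hy
  rw [div_le_iff₀' h2, dist_eq_norm, WithLp.prod_norm_eq_of_L2, ← Real.sqrt_mul (by norm_num)]
  refine Real.le_sqrt_of_sq_le ?_
  have h1 : ‖z.fst - z.snd‖ ≤ ‖(z - y).fst‖ + ‖(z - y).snd‖ := by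
    have e : z.fst - z.snd = (z - y).fst - (z - y).snd := by
      rw [WithLp.sub_fst, WithLp.sub_snd, hy]
      abel
    rw [e]
    exact norm_sub_le _ _
  nlinarith [norm_nonneg (z.fst - z.snd), sq_nonneg (‖(z - y).fst‖ - ‖(z - y).snd‖)]

theorem hasSum_norm_error (hp : p ≠ ⊤) (z : CompositeState E p) :
    HasSum (fun i => ‖z.fst i - z.snd i‖ ^ p.toReal) (‖z.fst - z.snd‖ ^ p.toReal) :=
  lp.hasSum_norm (ENNReal.toReal_pos (zero_lt_one.trans_le Fact.out).ne' hp) (z.fst - z.snd)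

theorem Icc_subset_timeInterval {T : EReal} {a b : ℝ} (ha : 0 ≤ a) (hb : b ∈ timeInterval T) :
    Set.Icc a b ⊆ timeInterval T := fun _ hs =>
  ⟨ha.trans hs.1, (EReal.coe_le_coe_iff.2 hs.2).trans_lt hb.2⟩

theorem exists_pos_mem_timeInterval {T : EReal} (hT : 0 < T) :
    ∃ b : ℝ, 0 < b ∧ b ∈ timeInterval T := by
  obtain ⟨b, hb0, hbT⟩ := EReal.lt_iff_exists_real_btwn.1 hT
  have hb0 : 0 < b := EReal.coe_lt_coe_iff.1 hb0
  exact ⟨b, hb0, hb0.le, hbT⟩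

/-! ### The composite Lyapunov function along solutions -/

namespace ObservedNetwork

variable [∀ i, NormedSpace ℝ (E i)] {q : ℕ → ℕ} {N : ObservedNetwork E q}

theorem IsSolution.apply_zero {z0 : CompositeState E p} {T : EReal} {ξ : ℝ → CompositeState E p}
    (h : N.IsSolution z0 T ξ) : ξ 0 = z0 := by
  obtain ⟨hT, -, v, -, hv⟩ := h
  simpa using (hv 0 ⟨le_rfl, by simpa using hT⟩).2

/-- The composite function dissipates at rate `κ` along solutions, in integrated form. -/
theorem IsSolution.sub_le_integral {V : ∀ i, E i × E i → ℝ} {lam μ : ℕ → ℝ} {γ : ℕ → ℕ → ℝ}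
    {κ K : ℝ} {W : CompositeState E p → ℝ} (hVcont : ∀ i, Continuous (V i))
    (hV0 : ∀ i x, 0 ≤ V i x) (hγzero : ∀ i, ∀ j ∉ N.nbr i, γ i j = 0)
    (hdiss : N.Dissipative p V lam γ) (hκ : 0 ≤ κ) (hK : 0 ≤ K)
    (hκsum : ∀ (s : Finset ℕ) (j : ℕ), ∑ i ∈ s, μ i * γ i j ≤ μ j * (lam j - κ))
    (hKsum : ∀ (s : Finset ℕ) (j : ℕ), ∑ i ∈ s, μ i * γ i j ≤ K * μ j) (hμ : ∀ i, 0 ≤ μ i)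
    (hWcont : Continuous W) (hW : ∀ z, HasSum (fun i => μ i * V i (z.fst i, z.snd i)) (W z))
    {z0 : CompositeState E p} {T : EReal} {ξ : ℝ → CompositeState E p} (hξ : N.IsSolution z0 T ξ)
    {a b : ℝ} (ha : 0 ≤ a) (hab : a ≤ b) (hb : b ∈ timeInterval T) :
    W (ξ b) - W (ξ a) ≤ ∫ t in a..b, -κ * W (ξ t) := by
  have hsub : Set.Icc a b ⊆ timeInterval T := Icc_subset_timeInterval ha hb
  have hξc : ContinuousOn ξ (Set.Icc a b) := hξ.2.1.mono hsub
  have hvc : ∀ i, ContinuousOn (fun t => V i ((ξ t).fst i, (ξ t).snd i)) (Set.Icc a b) := fun i =>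
    ((hVcont i).comp ((continuous_fst_coord i).prodMk (continuous_snd_coord i))).comp_continuousOn
      hξc
  refine weighted_sum_sub_le_integral (v := fun i t => V i ((ξ t).fst i, (ξ t).snd i))
    (w := fun t => W (ξ t)) hab hγzero hκ hK hκsum hKsum hμ (fun i t => hV0 i _) hvc
    (hWcont.comp_continuousOn hξc) (fun t => hW (ξ t)) fun i => ?_
  obtain ⟨hupper, hlower⟩ := hdiss z0 T ξ hξ i
  refine sub_le_integral_of_upperDini_le hab (hvc i)
    ((continuousOn_const.mul (hvc i)).add
      (continuousOn_finsetSum _ fun j _ => continuousOn_const.mul (hvc j))) ?_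
    fun t ht => hlower t (hsub (Set.Ico_subset_Icc_self ht))
  filter_upwards [hupper] with t ht htI using ht (hsub (Set.Ico_subset_Icc_self htI))

end ObservedNetwork

end

/-! ### Exponential stability under the small-gain condition -/

theorem theorem3
    (E : ℕ → Type*) [∀ i, NormedAddCommGroup (E i)] [∀ i, NormedSpace ℝ (E i)]
    [∀ i, FiniteDimensional ℝ (E i)] (q : ℕ → ℕ)
    (p : ℝ≥0∞) [Fact (1 ≤ p)] (hp : p ≠ ⊤)
    (N : ObservedNetwork E q)
    -- well-posedness of the composite system on `X × X`
    (hwp : N.WellPosed p)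
    -- error Lyapunov functions of the local observers
    (V : ∀ i, E i × E i → ℝ) (hVcont : ∀ i, Continuous (V i))
    (αl αu lam : ℕ → ℝ) (γ : ℕ → ℕ → ℝ)
    (hγpos : ∀ i, ∀ j ∈ N.nbr i, 0 < γ i j) (hγzero : ∀ i, ∀ j ∉ N.nbr i, γ i j = 0)
    (hV : ∀ i (x xhat : E i),
      αl i * ‖x - xhat‖ ^ p.toReal ≤ V i (x, xhat) ∧
      V i (x, xhat) ≤ αu i * ‖x - xhat‖ ^ p.toReal)
    (hdiss : N.Dissipative p V lam γ)
    -- uniformity of the constants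
    (αlow αup lamlow : ℝ) (hαlow : 0 < αlow) (hαup : 0 < αup) (hlamlow : 0 < lamlow)
    (hα : ∀ i, αlow ≤ αl i ∧ αl i ≤ αu i ∧ αu i ≤ αup)
    (hlam : ∀ i, lamlow ≤ lam i)
    -- boundedness of `Γ` on `ℓ¹`
    (hΓ : (⨆ j, ∑' i, ENNReal.ofReal (γ i j)) < ⊤)
    -- the gain operator `Ψ = Λ⁻¹ Γ` and the small-gain condition
    (Ψ : lp (fun _ : ℕ => ℂ) 1 →L[ℂ] lp (fun _ : ℕ => ℂ) 1)
    (hΨ : IsMatrixOperator (fun i j => γ i j / lam i) Ψ)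
    (hr : spectralRadius ℂ Ψ < 1) :
    (∃ (μ : ℕ → ℝ) (μlow μup : ℝ) (W : CompositeState E p → ℝ),
      0 < μlow ∧ 0 < μup ∧ (∀ i, μlow ≤ μ i ∧ μ i ≤ μup) ∧
      (∀ z : CompositeState E p, HasSum (fun i => μ i * V i (z.fst i, z.snd i)) (W z)) ∧
      N.IsExpLyapunov (diagonalSet E p) W ∧
      ContinuousOn W (diagonalSet E p)ᶜ ∧
      (∃ lamInf : ℝ, 0 < lamInf ∧
        ∀ z0 ∉ diagonalSet E p, ∀ (T : EReal) (ξ : ℝ → CompositeState E p),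
          N.IsSolution z0 T ξ →
            upperDini (fun t => W (ξ t)) 0 ≤ ((-lamInf * W z0 : ℝ) : EReal)) ∧
      ∀ z : CompositeState E p,
        μlow * αlow * Metric.infDist z (diagonalSet E p) ^ p.toReal ≤ W z ∧
        W z ≤ μup * αup * Metric.infDist z (diagonalSet E p) ^ p.toReal) ∧
    -- global exponential stability of the estimation error
    ∃ M a : ℝ, 0 < M ∧ 0 < a ∧
      ∀ (z0 : CompositeState E p) (T : EReal) (ξ : ℝ → CompositeState E p),
        N.IsSolution z0 T ξ → ∀ t ∈ timeInterval T,
          ‖(ξ t).fst - (ξ t).snd‖ ≤ M * Real.exp (-a * t) * ‖z0.fst - z0.snd‖ := by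
  have hp0 : 0 < p.toReal := ENNReal.toReal_pos (zero_lt_one.trans_le Fact.out).ne' hp
  have hγ : ∀ i j, 0 ≤ γ i j := fun i j => by
    by_cases hj : j ∈ N.nbr i
    · exact (hγpos i j hj).le
    · exact (hγzero i j hj).ge
  have hV0 : ∀ i x, 0 ≤ V i x := fun i x =>
    (mul_nonneg (hαlow.le.trans (hα i).1) (by positivity)).trans (hV i x.1 x.2).1
  obtain ⟨μ, μlow, μup, κ, K, hlow, hκ, hK, hμ, hκsum, hKsum⟩ :=
    exists_weights hlamlow hlam hγ hΓ hΨ hr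
  have hμ0 : ∀ i, 0 ≤ μ i := fun i => hlow.le.trans (hμ i).1
  have hup : 0 < μup := hlow.trans_le ((hμ 0).1.trans (hμ 0).2)
  have hterm0 : ∀ i (z : CompositeState E p), 0 ≤ μ i * V i (z.fst i, z.snd i) := fun i z =>
    mul_nonneg (hμ0 i) (hV0 i _)
  have hterm_le : ∀ i (z : CompositeState E p), μ i * V i (z.fst i, z.snd i) ≤
      μup * αup * ‖z.fst i - z.snd i‖ ^ p.toReal := fun i z => by
    rw [mul_assoc]
    refine mul_le_mul (hμ i).2 ((hV i _ _).2.trans ?_) (hV0 i _) hup.le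
    exact mul_le_mul_of_nonneg_right (hα i).2.2 (by positivity)
  have hterm_ge : ∀ i (z : CompositeState E p),
      μlow * αlow * ‖z.fst i - z.snd i‖ ^ p.toReal ≤ μ i * V i (z.fst i, z.snd i) := fun i z => by
    rw [mul_assoc]
    refine mul_le_mul (hμ i).1 (le_trans ?_ (hV i _ _).1) (by positivity) (hμ0 i)
    exact mul_le_mul_of_nonneg_right (hα i).1 (by positivity)
  have herr := hasSum_norm_error (E := E) hp
  set W : CompositeState E p → ℝ := fun z => ∑' i, μ i * V i (z.fst i, z.snd i) with hWdef
  have hW : ∀ z, HasSum (fun i => μ i * V i (z.fst i, z.snd i)) (W z) := fun z =>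
    (Summable.of_nonneg_of_le (fun i => hterm0 i z) (fun i => hterm_le i z)
      ((herr z).summable.mul_left _)).hasSum
  have hW0 : ∀ z, 0 ≤ W z := fun z => (hW z).nonneg fun i => hterm0 i z
  have hWle : ∀ z, W z ≤ μup * αup * ‖z.fst - z.snd‖ ^ p.toReal := fun z =>
    hasSum_le (fun i => hterm_le i z) (hW z) ((herr z).mul_left _)
  have hWge : ∀ z, μlow * αlow * ‖z.fst - z.snd‖ ^ p.toReal ≤ W z := fun z =>
    hasSum_le (fun i => hterm_ge i z) ((herr z).mul_left _) (hW z)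
  have hWcont : Continuous W := by
    refine continuous_of_hasSum_of_le (fun i => continuous_const.mul ((hVcont i).comp
        ((continuous_fst_coord i).prodMk (continuous_snd_coord i))))
      (fun i => continuous_const.mul
        (((continuous_fst_coord i).sub (continuous_snd_coord i)).norm.rpow_const
          fun _ => Or.inr hp0.le))
      (continuous_const.mul (continuous_norm_error.rpow_const fun _ => Or.inr hp0.le))
      hterm0 hterm_le hW fun z => (herr z).mul_left _
  have hdecay : ∀ (z0 : CompositeState E p) (T : EReal) (ξ : ℝ → CompositeState E p),
      N.IsSolution z0 T ξ → ∀ a b : ℝ, 0 ≤ a → a ≤ b → b ∈ timeInterval T →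
        W (ξ b) - W (ξ a) ≤ ∫ t in a..b, -κ * W (ξ t) := fun z0 T ξ hξ a b ha hab hb =>
    hξ.sub_le_integral hVcont hV0 hγzero hdiss hκ.le hK hκsum hKsum hμ0 hWcont hW ha hab hb
  have hWξ : ∀ (z0 : CompositeState E p) (T : EReal) (ξ : ℝ → CompositeState E p),
      N.IsSolution z0 T ξ → ∀ b ∈ timeInterval T,
        ContinuousOn (fun t => W (ξ t)) (Set.Icc 0 b) := fun z0 T ξ hξ b hb =>
    hWcont.comp_continuousOn (hξ.2.1.mono (Icc_subset_timeInterval le_rfl hb))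
  have hdini : ∀ (z0 : CompositeState E p) (T : EReal) (ξ : ℝ → CompositeState E p),
      N.IsSolution z0 T ξ → upperDini (fun t => W (ξ t)) 0 ≤ ((-κ * W z0 : ℝ) : EReal) := by
    intro z0 T ξ hξ
    obtain ⟨b, hb0, hb⟩ := exists_pos_mem_timeInterval hξ.1
    have := upperDini_zero_le_of_integral_decay hb0 (hWξ z0 T ξ hξ b hb) fun t ht =>
      hdecay z0 T ξ hξ 0 t le_rfl ht.1 (Icc_subset_timeInterval le_rfl hb ht)
    simpa only [hξ.apply_zero] using this
  -- the distance to the diagonal may be smaller than the error by the factor `√2`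
  have hsqrt : (1 : ℝ) ≤ √2 ^ p.toReal :=
    Real.one_le_rpow (Real.one_le_sqrt.2 one_le_two) hp0.le
  have hbounds : ∀ z : CompositeState E p,
      μlow * αlow * Metric.infDist z (diagonalSet E p) ^ p.toReal ≤ W z ∧
      W z ≤ μup * √2 ^ p.toReal * αup * Metric.infDist z (diagonalSet E p) ^ p.toReal := by
    intro z
    refine ⟨le_trans ?_ (hWge z), (hWle z).trans ?_⟩
    · exact mul_le_mul_of_nonneg_left (Real.rpow_le_rpow Metric.infDist_nonneg
        (infDist_diagonalSet_le z) hp0.le) (by positivity)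
    · have h1 := Real.rpow_le_rpow (norm_nonneg _) (norm_error_le z) hp0.le
      rw [Real.mul_rpow (by positivity) Metric.infDist_nonneg] at h1
      calc _ ≤ μup * αup * (√2 ^ p.toReal * Metric.infDist z (diagonalSet E p) ^ p.toReal) :=
            mul_le_mul_of_nonneg_left h1 (by positivity)
        _ = _ := by ring
  refine ⟨⟨μ, μlow, μup * √2 ^ p.toReal, W, hlow, by positivity,
    fun i => ⟨(hμ i).1, (hμ i).2.trans (le_mul_of_one_le_right hup.le hsqrt)⟩, hW,
    ⟨hW0, hWcont.continuousOn, _, _, p.toReal, κ, mul_pos hlow hαlow,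
      mul_pos (mul_pos hup (by positivity)) hαup, hp0, hκ, hbounds,
      fun z0 _ T ξ hξ => hdini z0 T ξ hξ⟩,
    hWcont.continuousOn, ⟨κ, hκ, fun z0 _ T ξ hξ => hdini z0 T ξ hξ⟩, hbounds⟩, ?_⟩
  set R : ℝ := μup * αup / (μlow * αlow) with hR
  have hR0 : 0 < R := by positivity
  refine ⟨R ^ p.toReal⁻¹, κ / p.toReal, by positivity, by positivity, fun z0 T ξ hξ t ht => ?_⟩
  have h1 := le_mul_exp_of_integral_decay ht.1 (hWξ z0 T ξ hξ t ht) fun x hx s hs =>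
    hdecay z0 T ξ hξ x s hx.1 hs.1 (Icc_subset_timeInterval le_rfl ht ⟨hx.1.trans hs.1, hs.2⟩)
  simp only [hξ.apply_zero, sub_zero] at h1
  rw [← Real.rpow_le_rpow_iff (norm_nonneg _) (by positivity) hp0,
    Real.mul_rpow (by positivity) (norm_nonneg _), Real.mul_rpow (by positivity) (by positivity),
    Real.rpow_inv_rpow hR0.le hp0.ne', ← Real.exp_mul,
    show -(κ / p.toReal) * t * p.toReal = -κ * t by field_simp, hR, div_mul_eq_mul_div,
    div_mul_eq_mul_div, le_div_iff₀' (by positivity)]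
  calc _ ≤ W (ξ t) := hWge _
    _ ≤ W z0 * Real.exp (-κ * t) := h1
    _ ≤ μup * αup * ‖z0.fst - z0.snd‖ ^ p.toReal * Real.exp (-κ * t) :=
        mul_le_mul_of_nonneg_right (hWle z0) (Real.exp_nonneg _)
    _ = _ := by ring
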